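/- Let $A$ be a unital $C^*$-algebra, let $\alpha^t$ ($t\in\mathbb{R}$) be a pointwise norm-continuous flow on $A$, i.e. an action of $\mathbb{R}$ by $*$-automorphisms such that $t\mapsto\alpha^t(a)$ is norm-continuous for every $a\in A$, and let $\beta\in\mathbb{R}$. Let $A^\infty_{\alpha^t}$ be the set of all $\alpha^t$-analytic elements, i.e. of those $a\in A$ for which $t\mapsto\alpha^t(a)$ extends to an entire function $z\mapsto\alpha^z(a)$ from $\mathbb{C}$ to $A$. An $(\alpha^t,\beta)$-KMS state is a state $\omega$ on $A$ with $\omega(ab)=\omega(b\,\alpha^{i\beta}(a))$ for all $a\in A^\infty_{\alpha^t}$ and $b\in A$. Let $A^{(2)}:=A\otimes_{\max}A^{\mathrm{op}}$ be the maximal $C^*$-tensor product of $A$ and its opposite algebra, with the canonical anti-isomorphism $a\mapsto a^{\mathrm{op}}$. For a unital $*$-representation $\Pi$ of $A^{(2)}$ on a Hilbert space $\mathcal{H}_\Pi$, a vector $\xi\in\mathcal{H}_\Pi$ is called $(\alpha^t,\beta)$-spherical if $$\Pi(a\otimes 1^{\mathrm{op}})\xi=\Pi\bigl(1\otimes(\alpha^{-i\beta/2}(a))^{\mathrm{op}}\bigr)\xi\qquad\text{for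 all } a\in A^\infty_{\alpha^t},$$ and $\mathcal{H}_\Pi^{(\alpha^t,\beta)}$ denotes the subspace of all such vectors. An $(\alpha^t,\beta)$-spherical representation of $A$ is a pair $(\Pi,\xi)$ of a unital $*$-representation $\Pi$ of $A^{(2)}$ and a unit vector $\xi\in\mathcal{H}_\Pi$ that is $(\alpha^t,\beta)$-spherical and cyclic for $\Pi(A^{(2)})$. Let $\Pi_{\mathrm{univ}}=\bigoplus_{\varphi}\pi_\varphi$ on $\mathcal{H}_{\mathrm{univ}}=\bigoplus_{\varphi}\mathcal{H}_\varphi$ be the universal representation of $A^{(2)}$, the direct sum of the GNS representations of all states $\varphi$ of $A^{(2)}$, and let $\mathcal{L}^\beta(\alpha^t)$ be the left ideal of $A^{(2)}$ generated by all the elements $a\otimes 1^{\mathrm{op}}-1\otimes(\alpha^{-i\beta/2}(a))^{\mathrm{op}}$ with $a\in A^\infty_{\alpha^t}$. Then the following four conditions are equivalent: (i) there exists an $(\alpha^t,\beta)$-KMS state on $A$; (ii) there exists an $(\alpha^t,\beta)$-spherical representation of $A$; (iii) $\dim\mathcal{H}_{\mathrm{univ}}^{(\alpha^t,\beta)}\geq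 1$, where $\mathcal{H}_{\mathrm{univ}}^{(\alpha^t,\beta)}$ is the space of $(\alpha^t,\beta)$-spherical vectors of $\Pi_{\mathrm{univ}}$; (iv) $\mathcal{L}^\beta(\alpha^t)\neq A^{(2)}$. -/

import Mathlib

open scoped TensorProduct ComplexOrder ENNReal InnerProductSpace

universe u

noncomputable section

namespace SphericalKMS

/-! ### The maximal tensor product of unital C⋆-algebras -/

section MaxTensor

variable (A B : Type u) [CStarAlgebra A] [CStarAlgebra B]

/-- The algebraic tensor product `A ⊙ B` over `ℂ`, a unital `⋆`-algebra, as a type of its own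
(it will carry the maximal C⋆-seminorm). -/
def AlgTensor : Type u := A ⊗[ℂ] B

namespace AlgTensor

instance : Ring (AlgTensor A B) := inferInstanceAs (Ring (A ⊗[ℂ] B))
instance : Algebra ℂ (AlgTensor A B) := inferInstanceAs (Algebra ℂ (A ⊗[ℂ] B))
instance : StarRing (AlgTensor A B) := inferInstanceAs (StarRing (A ⊗[ℂ] B))
instance : StarModule ℂ (AlgTensor A B) := inferInstanceAs (StarModule ℂ (A ⊗[ℂ] B))

variable {A B}

/-- The simple tensor `a ⊗ b`. -/
def tmul (a : A) (b : B) : AlgTensor A B := a ⊗ₜ[ℂ] b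

/-- All numbers `‖π x‖`, where `π` runs over the (unital) `⋆`-representations of `A ⊙ B` on
Hilbert spaces. -/
def repNorms (x : AlgTensor A B) : Set ℝ :=
  {r | ∃ (H : Type u) (_ : NormedAddCommGroup H) (_ : InnerProductSpace ℂ H) (_ : CompleteSpace H)
    (π : AlgTensor A B →⋆ₐ[ℂ] (H →L[ℂ] H)), r = ‖π x‖}

/-- The maximal C⋆-norm `‖x‖_max = sup {‖π x‖ : π a ⋆-representation of A ⊙ B}`. -/
def maxNorm (x : AlgTensor A B) : ℝ := sSup (repNorms x)

section aux

variable {H : Type u} [NormedAddCommGroup H] [InnerProductSpace ℂ H] [CompleteSpace H]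

lemma norm_rep_tmul_le (π : AlgTensor A B →⋆ₐ[ℂ] (H →L[ℂ] H)) (a : A) (b : B) :
    ‖π (tmul a b)‖ ≤ ‖a‖ * ‖b‖ := by
  let πA : A →⋆ₙₐ[ℂ] (H →L[ℂ] H) :=
    { toFun := fun a => π (tmul a 1)
      map_smul' := fun c a => by
        rw [show tmul (c • a) (1 : B) = c • tmul a 1 from TensorProduct.smul_tmul' ..]
        simp
      map_zero' := by
        rw [show tmul (0 : A) (1 : B) = 0 from TensorProduct.zero_tmul ..]; simp
      map_add' := fun a a' => by
        rw [show tmul (a + a') (1 : B) = tmul a 1 + tmul a' 1 from TensorProduct.add_tmul ..]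
        simp
      map_mul' := fun a a' => by
        rw [← map_mul]; congr 1
        exact ((Algebra.TensorProduct.tmul_mul_tmul ..).trans (by simp [tmul])).symm
      map_star' := fun a => by
        rw [← map_star]; congr 1
        exact ((TensorProduct.star_tmul ..).trans (by simp [tmul])).symm }
  let πB : B →⋆ₙₐ[ℂ] (H →L[ℂ] H) :=
    { toFun := fun b => π (tmul 1 b)
      map_smul' := fun c b => by
        rw [show tmul (1 : A) (c • b) = c • tmul 1 b from TensorProduct.tmul_smul ..]
        simp
      map_zero' := by
        rw [show tmul (1 : A) (0 : B) = 0 from TensorProduct.tmul_zero ..]; simp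
      map_add' := fun a a' => by
        rw [show tmul (1 : A) (a + a') = tmul 1 a + tmul 1 a' from TensorProduct.tmul_add ..]
        simp
      map_mul' := fun a a' => by
        rw [← map_mul]; congr 1
        exact ((Algebra.TensorProduct.tmul_mul_tmul ..).trans (by simp [tmul])).symm
      map_star' := fun a => by
        rw [← map_star]; congr 1
        exact ((TensorProduct.star_tmul ..).trans (by simp [tmul])).symm }
  have h : π (tmul a b) = πA a * πB b := by
    change _ = π (tmul a 1) * π (tmul 1 b)
    rw [← map_mul]; congr 1
    exact ((Algebra.TensorProduct.tmul_mul_tmul ..).trans (by simp [tmul])).symm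
  rw [h]
  exact (norm_mul_le _ _).trans (mul_le_mul (NonUnitalStarAlgHom.norm_apply_le πA a)
    (NonUnitalStarAlgHom.norm_apply_le πB b) (norm_nonneg _) (norm_nonneg _))

end aux

/-- The defining supremum is finite. -/
lemma bddAbove_repNorms (x : AlgTensor A B) : BddAbove (repNorms x) := by
  suffices h : ∃ C : ℝ, ∀ r ∈ repNorms x, r ≤ C from h
  refine TensorProduct.induction_on (motive := fun x : A ⊗[ℂ] B =>
    ∃ C : ℝ, ∀ r ∈ repNorms (A := A) (B := B) x, r ≤ C) x ?_ ?_ ?_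
  · refine ⟨0, ?_⟩
    rintro r ⟨H, _, _, _, π, rfl⟩
    exact ((congrArg norm (map_zero π)).trans norm_zero).le
  · intro a b
    refine ⟨‖a‖ * ‖b‖, ?_⟩
    rintro r ⟨H, _, _, _, π, rfl⟩
    exact norm_rep_tmul_le π a b
  · rintro x y ⟨C, hC⟩ ⟨D, hD⟩
    refine ⟨C + D, ?_⟩
    rintro r ⟨H, i1, i2, i3, π, rfl⟩
    rw [show π _ = _ from map_add π (x : AlgTensor A B) y]
    exact (norm_add_le _ _).trans
      (add_le_add (hC _ ⟨H, i1, i2, i3, π, rfl⟩) (hD _ ⟨H, i1, i2, i3, π, rfl⟩))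

lemma norm_rep_le_maxNorm {H : Type u} [i1 : NormedAddCommGroup H] [i2 : InnerProductSpace ℂ H]
    [i3 : CompleteSpace H] (π : AlgTensor A B →⋆ₐ[ℂ] (H →L[ℂ] H)) (x : AlgTensor A B) :
    ‖π x‖ ≤ maxNorm x :=
  le_csSup (bddAbove_repNorms x) ⟨H, i1, i2, i3, π, rfl⟩

lemma maxNorm_nonneg (x : AlgTensor A B) : 0 ≤ maxNorm x := by
  refine Real.sSup_nonneg ?_
  rintro r ⟨H, _, _, _, π, rfl⟩
  exact norm_nonneg _

lemma maxNorm_le {x : AlgTensor A B} {C : ℝ} (hC : 0 ≤ C)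
    (h : ∀ (H : Type u) [NormedAddCommGroup H] [InnerProductSpace ℂ H] [CompleteSpace H]
      (π : AlgTensor A B →⋆ₐ[ℂ] (H →L[ℂ] H)), ‖π x‖ ≤ C) : maxNorm x ≤ C := by
  refine Real.sSup_le ?_ hC
  rintro r ⟨H, _, _, _, π, rfl⟩
  exact h H π

lemma maxNorm_mul_le (x y : AlgTensor A B) : maxNorm (x * y) ≤ maxNorm x * maxNorm y := by
  refine maxNorm_le (mul_nonneg (maxNorm_nonneg x) (maxNorm_nonneg y)) fun H _ _ _ π => ?_
  rw [map_mul]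
  exact (norm_mul_le _ _).trans (mul_le_mul (norm_rep_le_maxNorm π x) (norm_rep_le_maxNorm π y)
    (norm_nonneg _) (maxNorm_nonneg x))

lemma maxNorm_smul_le (c : ℂ) (x : AlgTensor A B) : maxNorm (c • x) ≤ ‖c‖ * maxNorm x := by
  refine maxNorm_le (mul_nonneg (norm_nonneg c) (maxNorm_nonneg x)) fun H _ _ _ π => ?_
  rw [map_smul, norm_smul]
  exact mul_le_mul_of_nonneg_left (norm_rep_le_maxNorm π x) (norm_nonneg c)

lemma maxNorm_star_le (x : AlgTensor A B) : maxNorm (star x) ≤ maxNorm x := by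
  refine maxNorm_le (maxNorm_nonneg x) fun H _ _ _ π => ?_
  rw [map_star, norm_star]
  exact norm_rep_le_maxNorm π x

lemma maxNorm_mul_self_le (x : AlgTensor A B) : maxNorm x * maxNorm x ≤ maxNorm (star x * x) := by
  have h : maxNorm x ≤ √(maxNorm (star x * x)) := by
    refine maxNorm_le (Real.sqrt_nonneg _) fun H _ _ _ π => ?_
    refine Real.le_sqrt_of_sq_le ?_
    rw [sq, ← CStarRing.norm_star_mul_self, ← map_star, ← map_mul]
    exact norm_rep_le_maxNorm π _
  calc maxNorm x * maxNorm x
      ≤ √(maxNorm (star x * x)) * √(maxNorm (star x * x)) :=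
        mul_self_le_mul_self (maxNorm_nonneg x) h
    _ = maxNorm (star x * x) := Real.mul_self_sqrt (maxNorm_nonneg _)

variable (A B)

/-- The maximal C⋆-seminorm on `A ⊙ B`. -/
instance : SeminormedRing (AlgTensor A B) where
  __ := (inferInstance : Ring (AlgTensor A B))
  __ := AddGroupSeminorm.toSeminormedAddCommGroup
    { toFun := fun x : AlgTensor A B => maxNorm x
      map_zero' := le_antisymm
        (maxNorm_le le_rfl fun H _ _ _ π => by rw [map_zero, norm_zero]) (maxNorm_nonneg _)
      add_le' := fun x y =>
        maxNorm_le (add_nonneg (maxNorm_nonneg x) (maxNorm_nonneg y)) fun H _ _ _ π => by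
          rw [map_add]
          exact (norm_add_le _ _).trans
            (add_le_add (norm_rep_le_maxNorm π x) (norm_rep_le_maxNorm π y))
      neg' := fun x => by
        simp only [maxNorm, repNorms, map_neg, norm_neg] }
  norm_mul_le := maxNorm_mul_le

instance : NormedAlgebra ℂ (AlgTensor A B) where
  norm_smul_le := maxNorm_smul_le

instance : NormedStarGroup (AlgTensor A B) where
  norm_star_le := maxNorm_star_le

end AlgTensor

/-- The maximal C⋆-tensor product `A ⊗_max B`: the (Hausdorff) completion of `A ⊙ B` with respect
to the maximal C⋆-norm. -/
def MaxTensor : Type u := UniformSpace.Completion (AlgTensor A B)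

namespace MaxTensor

open UniformSpace

instance : NormedRing (MaxTensor A B) :=
  inferInstanceAs (NormedRing (Completion (AlgTensor A B)))

instance : CompleteSpace (MaxTensor A B) :=
  inferInstanceAs (CompleteSpace (Completion (AlgTensor A B)))

instance : NormedAlgebra ℂ (MaxTensor A B) where
  __ := (inferInstance : Algebra ℂ (Completion (AlgTensor A B)))
  norm_smul_le := fun c x => norm_smul_le c (show Completion (AlgTensor A B) from x)

variable {A B}

/-- The canonical map `A ⊙ B → A ⊗_max B`. -/
def ofAlg (x : AlgTensor A B) : MaxTensor A B := (x : Completion (AlgTensor A B))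

lemma isometry_ofAlg : Isometry (ofAlg : AlgTensor A B → MaxTensor A B) :=
  Completion.coe_isometry

lemma denseRange_ofAlg : DenseRange (ofAlg : AlgTensor A B → MaxTensor A B) :=
  Completion.denseRange_coe

lemma ofAlg_add (x y : AlgTensor A B) : ofAlg (x + y) = ofAlg x + ofAlg y :=
  Completion.coe_add x y

lemma ofAlg_mul (x y : AlgTensor A B) : ofAlg (x * y) = ofAlg x * ofAlg y :=
  Completion.coe_mul x y

lemma ofAlg_smul (c : ℂ) (x : AlgTensor A B) : ofAlg (c • x) = c • ofAlg x :=
  Completion.coe_smul c x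

lemma norm_ofAlg (x : AlgTensor A B) : ‖ofAlg x‖ = ‖x‖ :=
  Completion.norm_coe x

/-- The involution, extended by continuity from `A ⊙ B`. -/
instance : Star (MaxTensor A B) where
  star := Completion.map (star : AlgTensor A B → AlgTensor A B)

lemma star_ofAlg (x : AlgTensor A B) : star (ofAlg x) = ofAlg (star x) :=
  Completion.map_coe
    (starₗᵢ ℂ : AlgTensor A B ≃ₗᵢ⋆[ℂ] AlgTensor A B).isometry.uniformContinuous x

lemma continuous_star' : Continuous (star : MaxTensor A B → MaxTensor A B) :=
  Completion.continuous_map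

instance : StarRing (MaxTensor A B) where
  star_involutive x := by
    refine denseRange_ofAlg.induction_on (p := fun x => star (star x) = x) x
      (isClosed_eq (continuous_star'.comp continuous_star') continuous_id) fun x => ?_
    rw [star_ofAlg, star_ofAlg, star_star]
  star_mul x y := by
    refine denseRange_ofAlg.induction_on₂ (p := fun x y => star (x * y) = star y * star x)
      (isClosed_eq (continuous_star'.comp (by fun_prop))
        ((continuous_star'.comp continuous_snd).mul (continuous_star'.comp continuous_fst)))
      (fun x y => ?_) x y
    rw [← ofAlg_mul, star_ofAlg, star_ofAlg, star_ofAlg, star_mul, ofAlg_mul]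
  star_add x y := by
    refine denseRange_ofAlg.induction_on₂ (p := fun x y => star (x + y) = star x + star y)
      (isClosed_eq (continuous_star'.comp (by fun_prop))
        ((continuous_star'.comp continuous_fst).add (continuous_star'.comp continuous_snd)))
      (fun x y => ?_) x y
    rw [← ofAlg_add, star_ofAlg, star_ofAlg, star_ofAlg, star_add, ofAlg_add]

instance : StarModule ℂ (MaxTensor A B) where
  star_smul c x := by
    refine denseRange_ofAlg.induction_on (p := fun x => star (c • x) = star c • star x) x
      (isClosed_eq (continuous_star'.comp (continuous_const_smul c))
        (continuous_star'.const_smul (star c))) fun x => ?_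
    rw [← ofAlg_smul, star_ofAlg, star_ofAlg, star_smul, ofAlg_smul]

instance : CStarRing (MaxTensor A B) where
  norm_mul_self_le x := by
    refine denseRange_ofAlg.induction_on (p := fun x => ‖x‖ * ‖x‖ ≤ ‖star x * x‖) x
      (isClosed_le (by fun_prop) ((continuous_star'.mul continuous_id).norm)) fun x => ?_
    rw [star_ofAlg, ← ofAlg_mul, norm_ofAlg, norm_ofAlg]
    exact AlgTensor.maxNorm_mul_self_le x

instance : CStarAlgebra (MaxTensor A B) where

/-- The usual order on a C⋆-algebra: the positive elements are those of the form `x⋆ x`. -/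
instance : PartialOrder (MaxTensor A B) := CStarAlgebra.spectralOrder _

instance : StarOrderedRing (MaxTensor A B) := CStarAlgebra.spectralOrderedRing _

/-- The simple tensor `a ⊗ b` in `A ⊗_max B`. -/
def tmul (a : A) (b : B) : MaxTensor A B := ofAlg (AlgTensor.tmul a b)

end MaxTensor

end MaxTensor

/-! ### States and the universal representation -/

section States

/-- `ω` is a state: a positive linear functional with `ω 1 = 1`. -/
def IsState {B : Type u} [CStarAlgebra B] [PartialOrder B] (ω : B →ₚ[ℂ] ℂ) : Prop :=
  ω 1 = 1

variable (B : Type u) [CStarAlgebra B] [PartialOrder B] [StarOrderedRing B]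

/-- The state space `S(B)`. -/
def State : Type u := {φ : B →ₚ[ℂ] ℂ // IsState φ}

/-- The Hilbert space `⨁_φ H_φ` of the universal representation, the Hilbert space direct sum of
the GNS spaces over all states `φ` of `B`. -/
abbrev UnivSpace : Type u := lp (fun φ : State B => φ.1.GNS) 2

/-- The universal representation `⨁_φ π_φ`, with `(Π_univ(x) ξ)_φ = π_φ(x) ξ_φ`. -/
def univRep : B →⋆ₐ[ℂ] (UnivSpace B →L[ℂ] UnivSpace B) where
  toFun x := lp.mapCLM 2 (fun φ : State B => φ.1.gnsStarAlgHom x) (norm_nonneg x)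
    (fun φ => NonUnitalStarAlgHom.norm_apply_le φ.1.gnsStarAlgHom x)
  map_one' := by ext; simp
  map_mul' x y := by ext; simp
  map_zero' := by ext; simp
  map_add' x y := by ext; simp
  commutes' c := by ext; simp [Algebra.algebraMap_eq_smul_one]
  map_star' x := by
    refine (ContinuousLinearMap.eq_adjoint_iff _ _).2 fun ξ η => ?_
    rw [lp.inner_eq_tsum, lp.inner_eq_tsum]
    refine tsum_congr fun φ => ?_
    change ⟪φ.1.gnsStarAlgHom (star x) (ξ φ), η φ⟫_ℂ = ⟪ξ φ, φ.1.gnsStarAlgHom x (η φ)⟫_ℂ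
    rw [map_star, ContinuousLinearMap.star_eq_adjoint, ContinuousLinearMap.adjoint_inner_left]

lemma univRep_apply (x : B) (ξ : UnivSpace B) (φ : State B) :
    univRep B x ξ φ = φ.1.gnsStarAlgHom x (ξ φ) := rfl

end States

/-! ### Flows, analytic elements and KMS states -/

section Flows

variable (A : Type u) [CStarAlgebra A]

/-- A pointwise norm-continuous flow on `A`: an action `t ↦ α^t` of `ℝ` by `⋆`-automorphisms such
that `t ↦ α^t a` is norm-continuous for every `a`. -/
structure Flow where
  /-- The automorphism `α^t`. -/
  aut : ℝ → (A ≃⋆ₐ[ℂ] A)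
  aut_zero : ∀ a, aut 0 a = a
  aut_add : ∀ s t a, aut (s + t) a = aut s (aut t a)
  continuous_aut : ∀ a, Continuous fun t => aut t a

variable {A}

namespace Flow

variable (α : Flow A)

/-- `F` is an entire extension of the orbit map `t ↦ α^t a`. -/
def IsEntireExtension (a : A) (F : ℂ → A) : Prop :=
  Differentiable ℂ F ∧ ∀ t : ℝ, F t = α.aut t a

/-- The set of (entire) `α`-analytic elements of `A`. -/
def analyticElements : Set A := {a | ∃ F : ℂ → A, α.IsEntireExtension a F}

open Classical in
/-- `α^z a` for complex `z` and analytic `a`, the value at `z` of the entire extension of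
`t ↦ α^t a` (and `0` by convention if `a` is not analytic). -/
def complexAut (z : ℂ) (a : A) : A :=
  if h : a ∈ α.analyticElements then h.choose z else 0

variable {α}

/-- The entire extension is unique, so `complexAut` does not depend on a choice. -/
lemma IsEntireExtension.complexAut_eq {a : A} {F : ℂ → A} (hF : α.IsEntireExtension a F) (z : ℂ) :
    α.complexAut z a = F z := by
  have ha : a ∈ α.analyticElements := ⟨F, hF⟩
  rw [complexAut, dif_pos ha]
  have hG : α.IsEntireExtension a ha.choose := ha.choose_spec
  have key : ha.choose = F := by
    refine AnalyticOnNhd.eq_of_frequently_eq (𝕜 := ℂ) (z₀ := 0)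
      (fun w _ => hG.1.analyticAt w) (fun w _ => hF.1.analyticAt w) ?_
    have h1 : Filter.Tendsto (fun t : ℝ => (t : ℂ)) (nhdsWithin 0 {0}ᶜ) (nhdsWithin 0 {0}ᶜ) := by
      refine tendsto_nhdsWithin_iff.2 ⟨?_, ?_⟩
      · exact (Complex.continuous_ofReal.tendsto' 0 0 (by simp)).mono_left nhdsWithin_le_nhds
      · filter_upwards [self_mem_nhdsWithin] with t ht
        simpa using ht
    exact h1.frequently (Filter.Eventually.frequently
      (Filter.Eventually.of_forall fun t => by rw [hG.2, hF.2]))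
  rw [key]

end Flow

/-- `ω` is an `(α^t, β)`-KMS state: a state with `ω(a b) = ω(b α^{iβ}(a))` for all analytic `a` and
all `b`. -/
def IsKMSState [PartialOrder A] (α : Flow A) (β : ℝ) (ω : A →ₚ[ℂ] ℂ) : Prop :=
  IsState ω ∧ ∀ a ∈ α.analyticElements, ∀ b : A,
    ω (a * b) = ω (b * α.complexAut (Complex.I * β) a)

end Flows

/-! ### Spherical vectors and spherical representations -/

section Spherical

open MulOpposite

/-- `A^(2) = A ⊗_max A^op`. -/
abbrev Double (A : Type u) [CStarAlgebra A] : Type u := MaxTensor A Aᵐᵒᵖ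

variable {A : Type u} [CStarAlgebra A] (α : Flow A) (β : ℝ)
variable {H : Type u} [NormedAddCommGroup H] [InnerProductSpace ℂ H] [CompleteSpace H]

/-- The subspace of `(α^t, β)`-spherical vectors of a `⋆`-representation `ρ` of `A^(2)`: those `ξ`
with `ρ(a ⊗ 1^op) ξ = ρ(1 ⊗ (α^{-iβ/2}(a))^op) ξ` for all analytic `a`. -/
def sphericalVectors (ρ : Double A →⋆ₐ[ℂ] (H →L[ℂ] H)) : Submodule ℂ H where
  carrier := {ξ | ∀ a ∈ α.analyticElements,
    ρ (MaxTensor.tmul a (op 1)) ξ =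
      ρ (MaxTensor.tmul 1 (op (α.complexAut (-(Complex.I * β / 2)) a))) ξ}
  add_mem' hξ hη a ha := by rw [map_add, map_add, hξ a ha, hη a ha]
  zero_mem' a _ := by rw [map_zero, map_zero]
  smul_mem' c ξ hξ a ha := by rw [map_smul, map_smul, hξ a ha]

/-- `(ρ, ξ)` is an `(α^t, β)`-spherical representation of `A`: `ξ` is a unit vector, cyclic for
`ρ(A^(2))`, and `(α^t, β)`-spherical. -/
structure IsSphericalRepresentation (ρ : Double A →⋆ₐ[ℂ] (H →L[ℂ] H)) (ξ : H) : Prop where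
  norm_eq_one : ‖ξ‖ = 1
  cyclic : Dense (Set.range fun x : Double A => ρ x ξ)
  spherical : ξ ∈ sphericalVectors α β ρ

/-- The left ideal `𝓛^β(α^t)` of `A^(2)` generated by the elements
`a ⊗ 1^op - 1 ⊗ (α^{-iβ/2}(a))^op` with `a` analytic. -/
def sphericalLeftIdeal : Ideal (Double A) :=
  Ideal.span {x | ∃ a ∈ α.analyticElements,
    x = MaxTensor.tmul a (op 1) -
      MaxTensor.tmul 1 (op (α.complexAut (-(Complex.I * β / 2)) a))}

end Spherical

end SphericalKMS

end

/-! The conditions are linked in the cycle (i) ⇒ (ii) ⇒ (iv) ⇒ (iii) ⇒ (i).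

(i) ⇒ (ii) carries the weight. On the GNS space of a KMS state `ω`, the left action of `A` should
commute with a right action `R_b : x ↦ x α^{iβ/2}(b)`, first for analytic `b`. The KMS condition
gives `R_b^* = R_{b^*}`, and `R_{bc} = R_c R_b`, so only the bound `‖R_b‖ ≤ ‖b‖` is at stake. The
three lines theorem gives a crude bound involving the norm of `x` in `A`
(`exists_norm_rightMulₗ_le`). For self-adjoint `h` the sequence `‖R_{h^n} x‖` is log-convex, so its
growth rate controls its first step and the crude constant disappears
(`norm_rightMulₗ_le_of_isSelfAdjoint`). The identity `‖R_b x‖² = ⟪x, R_{bb^*} x⟫` then handles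
general `b`. Gaussian averaging makes analytic elements dense, so `R` extends to a representation of
`Aᵐᵒᵖ`, and the GNS vector is spherical for the combined representation of `A ⊗_max Aᵐᵒᵖ`.

(ii) ⇒ (iv): the left ideal kills a nonzero vector, so it cannot contain `1`. (iv) ⇒ (iii): a proper
left ideal has distance at least one from `1`, so by Hahn–Banach some state vanishes on it, and the
GNS vector of that state is spherical. (iii) ⇒ (i): the vector state of a normalised spherical
vector, restricted to `A ⊗ 1`, is KMS because the two tensor legs commute. -/

noncomputable section

namespace SphericalKMS

/-! ### Calculus of the complexified flow on analytic elements. -/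

namespace Flow

variable {A : Type u} [CStarAlgebra A] {α : Flow A}

lemma norm_aut (α : Flow A) (t : ℝ) (a : A) : ‖α.aut t a‖ = ‖a‖ :=
  NonUnitalStarAlgHom.norm_map (α.aut t) (α.aut t).injective a

/-- The automorphism `α^t` as a continuous linear map. -/
def autCLM (α : Flow A) (t : ℝ) : A →L[ℂ] A :=
  (α.aut t : A →ₗ[ℂ] A).mkContinuous 1 fun a => by
    rw [one_mul]; exact (α.norm_aut t a).le

@[simp] lemma autCLM_apply (t : ℝ) (a : A) : α.autCLM t a = α.aut t a := rfl

lemma continuous_aut_comp {f : ℝ → ℝ} (hf : Continuous f) (a : A) :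
    Continuous fun t => α.aut (f t) a :=
  (α.continuous_aut a).comp hf

lemma isEntireExtension_complexAut {a : A} (ha : a ∈ α.analyticElements) :
    α.IsEntireExtension a (fun z => α.complexAut z a) := by
  obtain ⟨F, hF⟩ := ha
  have : (fun z => α.complexAut z a) = F := funext hF.complexAut_eq
  rwa [this]

namespace IsEntireExtension

variable {a b : A} {F G : ℂ → A}

lemma mem (hF : α.IsEntireExtension a F) : a ∈ α.analyticElements := ⟨F, hF⟩

lemma unique (hF : α.IsEntireExtension a F) (hG : α.IsEntireExtension a G) (z : ℂ) :
    F z = G z :=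
  (hF.complexAut_eq z).symm.trans (hG.complexAut_eq z)

lemma add (hF : α.IsEntireExtension a F) (hG : α.IsEntireExtension b G) :
    α.IsEntireExtension (a + b) (fun z => F z + G z) :=
  ⟨hF.1.add hG.1, fun t => by beta_reduce; rw [hF.2, hG.2, map_add]⟩

lemma mul (hF : α.IsEntireExtension a F) (hG : α.IsEntireExtension b G) :
    α.IsEntireExtension (a * b) (fun z => F z * G z) :=
  ⟨hF.1.mul hG.1, fun t => by beta_reduce; rw [hF.2, hG.2, map_mul]⟩

lemma smul (c : ℂ) (hF : α.IsEntireExtension a F) :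
    α.IsEntireExtension (c • a) (fun z => c • F z) :=
  ⟨hF.1.const_smul c, fun t => by beta_reduce; rw [hF.2, map_smul]⟩

lemma star_conj (hF : α.IsEntireExtension a F) :
    α.IsEntireExtension (star a) (fun z => star (F (star z))) :=
  ⟨fun z => by
    have h := (hF.1 (star z)).star_conj
    rwa [show (starRingEnd ℂ) (star z) = z from star_star z] at h, fun t => by
    beta_reduce
    rw [show star (F (star (t : ℂ))) = star (F t) by
      rw [show star (t : ℂ) = t from Complex.conj_ofReal t], hF.2, map_star]⟩

lemma map_aut (t : ℝ) (hF : α.IsEntireExtension a F) :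
    α.IsEntireExtension (α.aut t a) (fun z => α.aut t (F z)) :=
  ⟨(α.autCLM t).differentiable.comp hF.1, fun s => by
    beta_reduce
    rw [hF.2, ← α.aut_add, ← α.aut_add, add_comm]⟩

/-- Both sides, as functions of `z`, are entire extensions of the orbit of `α^t a`, so uniqueness
identifies them. -/
lemma aut_eq (hF : α.IsEntireExtension a F) (t : ℝ) (z : ℂ) : α.aut t (F z) = F (t + z) := by
  refine (hF.map_aut t).unique (G := fun z => F (t + z)) ⟨?_, fun s => ?_⟩ z
  · exact hF.1.comp (differentiable_id.const_add _)
  · beta_reduce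
    rw [← Complex.ofReal_add, hF.2, ← α.aut_add, add_comm]

lemma shift (hF : α.IsEntireExtension a F) (w : ℂ) :
    α.IsEntireExtension (F w) (fun z => F (z + w)) :=
  ⟨hF.1.comp (differentiable_id.add_const _), fun t => (hF.aut_eq t w).symm⟩

lemma apply_zero (hF : α.IsEntireExtension a F) : F 0 = a := by
  simpa [α.aut_zero] using hF.2 0

end IsEntireExtension

lemma isEntireExtension_one : α.IsEntireExtension 1 (fun _ => 1) :=
  ⟨differentiable_const _, fun _ => (map_one _).symm⟩

lemma isEntireExtension_zero : α.IsEntireExtension 0 (fun _ => 0) :=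
  ⟨differentiable_const _, fun _ => (map_zero _).symm⟩

section complexAut

variable {a b : A}

lemma star_mem (ha : a ∈ α.analyticElements) : star a ∈ α.analyticElements :=
  (isEntireExtension_complexAut ha).star_conj.mem

lemma mul_mem (ha : a ∈ α.analyticElements) (hb : b ∈ α.analyticElements) :
    a * b ∈ α.analyticElements :=
  ((isEntireExtension_complexAut ha).mul (isEntireExtension_complexAut hb)).mem

lemma one_mem : (1 : A) ∈ α.analyticElements := isEntireExtension_one.mem

lemma complexAut_mem (z : ℂ) (ha : a ∈ α.analyticElements) :
    α.complexAut z a ∈ α.analyticElements :=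
  ((isEntireExtension_complexAut ha).shift z).mem

lemma complexAut_zero (ha : a ∈ α.analyticElements) : α.complexAut 0 a = a :=
  (isEntireExtension_complexAut ha).apply_zero

lemma complexAut_one (z : ℂ) : α.complexAut z (1 : A) = 1 :=
  isEntireExtension_one.complexAut_eq z

lemma complexAut_add (z : ℂ) (ha : a ∈ α.analyticElements) (hb : b ∈ α.analyticElements) :
    α.complexAut z (a + b) = α.complexAut z a + α.complexAut z b :=
  ((isEntireExtension_complexAut ha).add (isEntireExtension_complexAut hb)).complexAut_eq z

lemma complexAut_mul (z : ℂ) (ha : a ∈ α.analyticElements) (hb : b ∈ α.analyticElements) :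
    α.complexAut z (a * b) = α.complexAut z a * α.complexAut z b :=
  ((isEntireExtension_complexAut ha).mul (isEntireExtension_complexAut hb)).complexAut_eq z

lemma complexAut_smul (z c : ℂ) (ha : a ∈ α.analyticElements) :
    α.complexAut z (c • a) = c • α.complexAut z a :=
  ((isEntireExtension_complexAut ha).smul c).complexAut_eq z

lemma complexAut_star (z : ℂ) (ha : a ∈ α.analyticElements) :
    α.complexAut z (star a) = star (α.complexAut (star z) a) :=
  (isEntireExtension_complexAut ha).star_conj.complexAut_eq z

lemma complexAut_complexAut (z w : ℂ) (ha : a ∈ α.analyticElements) :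
    α.complexAut z (α.complexAut w a) = α.complexAut (z + w) a :=
  ((isEntireExtension_complexAut ha).shift w).complexAut_eq z

/-- `α^{x+iy} = α^x ∘ α^{iy}` with `α^x` isometric. Orbits are thus bounded on horizontal strips of
finite width, as the three lines theorem requires. -/
lemma norm_complexAut (z : ℂ) (ha : a ∈ α.analyticElements) :
    ‖α.complexAut z a‖ = ‖α.complexAut (z.im * Complex.I) a‖ := by
  have h := (isEntireExtension_complexAut ha).aut_eq z.re (z.im * Complex.I)
  rw [Complex.re_add_im] at h
  rw [← h, norm_aut]

end complexAut

/-- The subspace of entire analytic elements. -/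
def analyticSubmodule (α : Flow A) : Submodule ℂ A where
  carrier := α.analyticElements
  add_mem' ha hb := ((isEntireExtension_complexAut ha).add (isEntireExtension_complexAut hb)).mem
  zero_mem' := isEntireExtension_zero.mem
  smul_mem' c _ ha := ((isEntireExtension_complexAut ha).smul c).mem

end Flow

end SphericalKMS

namespace SphericalKMS

/-! ### Gaussian transforms are entire. -/

section Gaussian

open MeasureTheory Filter Topology

variable {E : Type*} [NormedAddCommGroup E] [NormedSpace ℂ E]

/-- The factor `|t|` comes from differentiating in `w`; it is absorbed by `|t| ≤ exp |t|`.
Completing the square in `(2K + 1)|t| - t²` leaves half of the Gaussian decay. -/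
lemma norm_cexp_mul_sub_sq_le {K t : ℝ} {w : ℂ} (hw : ‖w‖ ≤ K) :
    ‖Complex.exp (2 * t * w - t ^ 2)‖ * |t| ≤
      Real.exp ((2 * K + 1) ^ 2 / 2) * Real.exp (-(1 / 2) * t ^ 2) := by
  rw [Complex.norm_exp, ← Real.exp_add]
  have h1 : |t| ≤ Real.exp |t| := by linarith [Real.add_one_le_exp |t|]
  have h2 : (2 * (t : ℂ) * w - (t : ℂ) ^ 2).re = 2 * (t * w.re) - t ^ 2 := by
    rw [← Complex.ofReal_pow, mul_assoc, Complex.sub_re, Complex.ofReal_re]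
    simp
  have h3 : t * w.re ≤ |t| * K :=
    (le_abs_self _).trans ((abs_mul t w.re).le.trans
      (mul_le_mul_of_nonneg_left ((Complex.abs_re_le_norm w).trans hw) (abs_nonneg t)))
  calc _ ≤ Real.exp (2 * (t * w.re) - t ^ 2) * Real.exp |t| := by
        rw [h2]; gcongr
    _ = Real.exp (2 * (t * w.re) - t ^ 2 + |t|) := (Real.exp_add _ _).symm
    _ ≤ _ := by
        refine Real.exp_le_exp.2 ?_
        nlinarith [sq_nonneg (|t| - (2 * K + 1)), sq_abs t]

/-- The Gaussian transform of a bounded continuous function is entire. -/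
lemma differentiable_integral_cexp_smul {f : ℝ → E} (hf : Continuous f) {C : ℝ}
    (hC : ∀ t, ‖f t‖ ≤ C) :
    Differentiable ℂ fun w : ℂ => ∫ t : ℝ, Complex.exp (2 * t * w - t ^ 2) • f t := by
  intro w₀
  have hC0 : 0 ≤ C := (norm_nonneg _).trans (hC 0)
  -- Bounds `‖w‖` on the unit ball around `w₀`, where the derivative must be dominated uniformly.
  set K := ‖w₀‖ + 1
  have hint (w : ℂ) : Integrable fun t : ℝ => Complex.exp (2 * t * w - t ^ 2) • f t := by
    have h1 : Integrable fun t : ℝ => Complex.exp (2 * t * w - t ^ 2) := by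
      have := integrable_cexp_quadratic (b := 1) (by simp) (2 * w) 0
      refine this.congr (Eventually.of_forall fun t => ?_)
      beta_reduce
      congr 1
      ring
    refine (h1.norm.mul_const C).mono' (by fun_prop) (Eventually.of_forall fun t => ?_)
    rw [norm_smul]
    exact mul_le_mul_of_nonneg_left (hC t) (norm_nonneg _)
  refine (hasDerivAt_integral_of_dominated_loc_of_deriv_le (𝕜 := ℂ) (μ := volume)
    (F := fun w (t : ℝ) => Complex.exp (2 * t * w - t ^ 2) • f t)
    (F' := fun w (t : ℝ) => (Complex.exp (2 * t * w - t ^ 2) * (2 * t)) • f t)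
    (bound := fun t => 2 * C * (Real.exp ((2 * K + 1) ^ 2 / 2) * Real.exp (-(1 / 2) * t ^ 2)))
    (Metric.ball_mem_nhds w₀ one_pos) (Eventually.of_forall fun w => (hint w).1) (hint w₀)
    (by fun_prop) (Eventually.of_forall fun t w hw => ?_) ?_
    (Eventually.of_forall fun t w hw => ?_)).2.differentiableAt
  · have hwK : ‖w‖ ≤ K := by
      have := norm_le_norm_add_norm_sub' w w₀
      rw [Metric.mem_ball, dist_eq_norm] at hw
      linarith
    have := norm_cexp_mul_sub_sq_le (t := t) hwK
    rw [norm_smul, norm_mul, norm_mul, Complex.norm_real, Complex.norm_ofNat, Real.norm_eq_abs]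
    calc _ = (‖Complex.exp (2 * t * w - t ^ 2)‖ * |t|) * 2 * ‖f t‖ := by ring
      _ ≤ (Real.exp ((2 * K + 1) ^ 2 / 2) * Real.exp (-(1 / 2) * t ^ 2)) * 2 * C := by
        gcongr
        exact hC t
      _ = _ := by ring
  · exact ((integrable_exp_neg_mul_sq (by norm_num)).const_mul _).const_mul _
  · have h : HasDerivAt (fun w : ℂ => 2 * (t : ℂ) * w - (t : ℂ) ^ 2) (2 * (t : ℂ)) w := by
      simpa using ((hasDerivAt_id w).const_mul (2 * (t : ℂ))).sub_const ((t : ℂ) ^ 2)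
    exact h.cexp.smul_const (f t)

end Gaussian

/-! ### Density of the analytic elements. -/

namespace Flow

open MeasureTheory Filter Topology

variable {A : Type u} [CStarAlgebra A] (α : Flow A)

/-- Gaussian averages along the flow are analytic. -/
lemma integral_gaussian_smul_mem (a : A) {ε : ℝ} (hε : ε ≠ 0) :
    ∫ t : ℝ, Complex.exp (-(t : ℂ) ^ 2) • α.aut (ε * t) a ∈ α.analyticElements := by
  have hcont : Continuous fun t : ℝ => α.aut (ε * t) a :=
    α.continuous_aut_comp (by fun_prop) a
  have hint : Integrable fun t : ℝ => Complex.exp (-(t : ℂ) ^ 2) • α.aut (ε * t) a := by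
    have h1 : Integrable fun t : ℝ => Complex.exp (-(t : ℂ) ^ 2) := by
      simpa using integrable_cexp_quadratic (b := 1) (by simp) 0 0
    refine (h1.norm.mul_const ‖a‖).mono' (by fun_prop) (Eventually.of_forall fun t => ?_)
    rw [norm_smul, α.norm_aut]
  -- For real `s`, translation invariance moves `α^s` onto the kernel, which becomes `exp(-(t -
  -- s/ε)²)`. Expanding the square and replacing `s` by `z` gives this extension.
  refine ⟨fun z => Complex.exp (-(z / ε) ^ 2) •
    ∫ t : ℝ, Complex.exp (2 * t * (z / ε) - t ^ 2) • α.aut (ε * t) a, ?_, fun s => ?_⟩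
  · have h := differentiable_integral_cexp_smul hcont (C := ‖a‖) fun t => (α.norm_aut _ a).le
    have h2 : Differentiable ℂ fun z : ℂ => z / (ε : ℂ) := differentiable_id.div_const _
    exact ((h2.pow 2).neg.cexp).smul (h.comp h2)
  · have key := integral_add_right_eq_self (μ := volume)
      (fun t : ℝ => Complex.exp (-((t : ℂ) - s / ε) ^ 2) • α.aut (ε * t) a) (s / ε)
    beta_reduce
    rw [← autCLM_apply, ← ContinuousLinearMap.integral_comp_comm _ hint, ← integral_smul]
    trans ∫ t : ℝ, Complex.exp (-((t : ℂ) - s / ε) ^ 2) • α.aut (ε * t) a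
    · refine integral_congr_ae (Eventually.of_forall fun t => ?_)
      beta_reduce
      rw [smul_smul, ← Complex.exp_add]
      congr 2
      ring
    · rw [← key]
      refine integral_congr_ae (Eventually.of_forall fun t => ?_)
      beta_reduce
      rw [map_smul, autCLM_apply, ← α.aut_add, mul_add, mul_div_cancel₀ _ hε, add_comm s]
      simp

/-- As `ε → 0` the Gaussian averages of the orbit converge to `√π • a`; the closure of the analytic
elements is a subspace, so the nonzero scalar can be removed. -/
lemma dense_analyticElements : Dense (α.analyticElements) := by
  intro a
  have hlim : Tendsto (fun ε : ℝ => ∫ t : ℝ, Complex.exp (-(t : ℂ) ^ 2) • α.aut (ε * t) a)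
      (𝓝[≠] 0) (𝓝 (∫ t : ℝ, Complex.exp (-(t : ℂ) ^ 2) • a)) := by
    refine tendsto_integral_filter_of_dominated_convergence
      (fun t : ℝ => ‖Complex.exp (-(t : ℂ) ^ 2)‖ * ‖a‖) (Eventually.of_forall fun ε => ?_)
      (Eventually.of_forall fun ε => Eventually.of_forall fun t => ?_) ?_
      (Eventually.of_forall fun t => ?_)
    · have hcont : Continuous fun t : ℝ => α.aut (ε * t) a :=
        α.continuous_aut_comp (by fun_prop) a
      fun_prop
    · rw [norm_smul, α.norm_aut]
    · refine Integrable.mul_const (Integrable.norm ?_) _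
      simpa using integrable_cexp_quadratic (b := 1) (by simp) 0 0
    · have hcont : Continuous fun ε : ℝ => α.aut (ε * t) a :=
        α.continuous_aut_comp (by fun_prop) a
      have := (hcont.tendsto 0).mono_left (nhdsWithin_le_nhds (s := {0}ᶜ))
      rw [zero_mul, α.aut_zero] at this
      exact this.const_smul _
  have hmem : ∫ t : ℝ, Complex.exp (-(t : ℂ) ^ 2) • a ∈ α.analyticSubmodule.topologicalClosure :=
    mem_closure_of_tendsto hlim (by
      filter_upwards [self_mem_nhdsWithin] with ε hε
      exact α.integral_gaussian_smul_mem a hε)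
  rw [integral_smul_const] at hmem
  have hne : ∫ t : ℝ, Complex.exp (-(t : ℂ) ^ 2) ≠ 0 := by
    have := integral_gaussian_complex (b := 1) (by simp)
    simp only [neg_mul, one_mul, div_one] at this
    rw [this]
    simp [Real.pi_ne_zero]
  exact (Submodule.smul_mem_iff _ hne).1 hmem

lemma denseRange_analyticSubmodule_subtype : DenseRange α.analyticSubmodule.subtype := by
  have h : Set.range α.analyticSubmodule.subtype = α.analyticElements := Subtype.range_coe
  rw [DenseRange, h]
  exact α.dense_analyticElements

end Flow

end SphericalKMS

namespace SphericalKMS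

/-! ### Representations of the maximal tensor product -/

section MaxTensor

variable {A B : Type u} [CStarAlgebra A] [CStarAlgebra B]

namespace AlgTensor

/-- A pair of commuting `⋆`-homomorphisms defines a `⋆`-homomorphism on `A ⊙ B`. -/
def lift {C : Type*} [Ring C] [Algebra ℂ C] [StarRing C]
    (f : A →⋆ₐ[ℂ] C) (g : B →⋆ₐ[ℂ] C) (hfg : ∀ a b, Commute (f a) (g b)) :
    AlgTensor A B →⋆ₐ[ℂ] C :=
  let φ : AlgTensor A B →ₐ[ℂ] C :=
    (Algebra.TensorProduct.lift f.toAlgHom g.toAlgHom hfg : A ⊗[ℂ] B →ₐ[ℂ] C)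
  have hφ (a : A) (b : B) : φ (tmul a b) = f a * g b :=
    Algebra.TensorProduct.lift_tmul f.toAlgHom g.toAlgHom hfg a b
  { φ with
    map_star' := fun x => by
      change φ (star x) = star (φ x)
      refine TensorProduct.induction_on
        (motive := fun x : A ⊗[ℂ] B => φ (star (show AlgTensor A B from x)) = star (φ x))
        x ?_ ?_ ?_
      · change φ (star (0 : AlgTensor A B)) = star (φ 0)
        simp
      · intro a b
        change φ (star (tmul a b)) = star (φ (tmul a b))
        rw [show star (tmul a b) = tmul (star a) (star b) from TensorProduct.star_tmul ..,
          hφ, hφ, star_mul, map_star, map_star, ← map_star, ← map_star, (hfg _ _).eq]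
      · intro x y hx hy
        change φ (star ((show AlgTensor A B from x) + (show AlgTensor A B from y))) =
          star (φ ((show AlgTensor A B from x) + (show AlgTensor A B from y)))
        rw [star_add, map_add, map_add, star_add]
        exact congrArg₂ (· + ·) hx hy }

lemma lift_tmul {C : Type*} [Ring C] [Algebra ℂ C] [StarRing C]
    (f : A →⋆ₐ[ℂ] C) (g : B →⋆ₐ[ℂ] C) (hfg : ∀ a b, Commute (f a) (g b)) (a : A) (b : B) :
    lift f g hfg (tmul a b) = f a * g b :=
  Algebra.TensorProduct.lift_tmul f.toAlgHom g.toAlgHom hfg a b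

end AlgTensor

namespace MaxTensor

variable {H : Type u} [NormedAddCommGroup H] [InnerProductSpace ℂ H] [CompleteSpace H]

/-- The canonical map `A ⊙ B → A ⊗_max B` as a linear map. -/
def ofAlgₗ : AlgTensor A B →ₗ[ℂ] MaxTensor A B where
  toFun := ofAlg
  map_add' := ofAlg_add
  map_smul' := ofAlg_smul

/-- The continuous extension to `A ⊗_max B` of a representation of `A ⊙ B`. -/
def extendCLM (π : AlgTensor A B →⋆ₐ[ℂ] (H →L[ℂ] H)) : MaxTensor A B →L[ℂ] (H →L[ℂ] H) :=
  LinearMap.extendOfNorm (π : AlgTensor A B →ₗ[ℂ] (H →L[ℂ] H)) ofAlgₗ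

/-- The maximal norm dominates the norm in every representation, which is the bound that the
extension needs. -/
lemma extendCLM_ofAlg (π : AlgTensor A B →⋆ₐ[ℂ] (H →L[ℂ] H)) (x : AlgTensor A B) :
    extendCLM π (ofAlg x) = π x :=
  LinearMap.extendOfNorm_eq (f := (π : AlgTensor A B →ₗ[ℂ] (H →L[ℂ] H))) (e := ofAlgₗ)
    denseRange_ofAlg ⟨1, fun x => by
      rw [one_mul]
      exact (AlgTensor.norm_rep_le_maxNorm π x).trans (norm_ofAlg x).ge⟩ x

lemma ofAlg_one : ofAlg (1 : AlgTensor A B) = 1 := rfl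

/-- Every representation of `A ⊙ B` extends to a representation of `A ⊗_max B`. -/
def extend (π : AlgTensor A B →⋆ₐ[ℂ] (H →L[ℂ] H)) : MaxTensor A B →⋆ₐ[ℂ] (H →L[ℂ] H) :=
  have hone : extendCLM π 1 = 1 := by rw [← ofAlg_one, extendCLM_ofAlg, map_one]
  { toFun := extendCLM π
    map_one' := hone
    map_mul' := fun x y => by
      refine denseRange_ofAlg.induction_on₂
        (p := fun x y => extendCLM π (x * y) = extendCLM π x * extendCLM π y)
        (isClosed_eq (by fun_prop) (by fun_prop)) (fun x y => ?_) x y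
      rw [← ofAlg_mul, extendCLM_ofAlg, extendCLM_ofAlg, extendCLM_ofAlg, map_mul]
    map_zero' := map_zero _
    map_add' := map_add _
    commutes' := fun c => by
      rw [Algebra.algebraMap_eq_smul_one, map_smul, hone, Algebra.algebraMap_eq_smul_one]
    map_star' := fun x => by
      refine denseRange_ofAlg.induction_on
        (p := fun x => extendCLM π (star x) = star (extendCLM π x)) x
        (isClosed_eq ((extendCLM π).continuous.comp continuous_star')
          (extendCLM π).continuous.star) fun x => ?_
      rw [star_ofAlg, extendCLM_ofAlg, extendCLM_ofAlg, map_star] }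

/-- The representation of `A ⊗_max B` given by a pair of commuting representations. -/
def lift (f : A →⋆ₐ[ℂ] (H →L[ℂ] H)) (g : B →⋆ₐ[ℂ] (H →L[ℂ] H))
    (hfg : ∀ a b, Commute (f a) (g b)) : MaxTensor A B →⋆ₐ[ℂ] (H →L[ℂ] H) :=
  extend (AlgTensor.lift f g hfg)

lemma lift_tmul (f : A →⋆ₐ[ℂ] (H →L[ℂ] H)) (g : B →⋆ₐ[ℂ] (H →L[ℂ] H))
    (hfg : ∀ a b, Commute (f a) (g b)) (a : A) (b : B) :
    lift f g hfg (tmul a b) = f a * g b :=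
  (extendCLM_ofAlg _ _).trans (AlgTensor.lift_tmul f g hfg a b)

lemma tmul_mul_tmul (a a' : A) (b b' : B) :
    tmul a b * tmul a' b' = tmul (a * a') (b * b') := by
  rw [tmul, tmul, ← ofAlg_mul]
  exact congrArg ofAlg (Algebra.TensorProduct.tmul_mul_tmul ..)

lemma star_tmul (a : A) (b : B) : star (tmul a b) = tmul (star a) (star b) := by
  rw [tmul, star_ofAlg]
  exact congrArg ofAlg (TensorProduct.star_tmul ..)

lemma tmul_one_one : tmul (1 : A) (1 : B) = 1 := rfl

lemma tmul_add_left (a a' : A) (b : B) : tmul (a + a') b = tmul a b + tmul a' b := by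
  rw [tmul, tmul, tmul, ← ofAlg_add]
  exact congrArg ofAlg (TensorProduct.add_tmul ..)

lemma tmul_smul_left (c : ℂ) (a : A) (b : B) : tmul (c • a) b = c • tmul a b := by
  rw [tmul, tmul, ← ofAlg_smul]
  exact congrArg ofAlg (TensorProduct.smul_tmul' ..).symm

end MaxTensor

end MaxTensor

end SphericalKMS

namespace SphericalKMS

/-! ### The right action on the GNS space of a KMS state -/

/-- A nonnegative log-convex sequence of growth `O(r ^ n)` grows at rate at most `r` initially. -/
lemma le_mul_of_sq_le_mul_of_le_pow {u : ℕ → ℝ} {r D : ℝ} (h0 : ∀ n, 0 ≤ u n) (hr : 0 ≤ r)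
    (hconv : ∀ n, u (n + 1) ^ 2 ≤ u n * u (n + 2)) (hD : ∀ n, u n ≤ D * r ^ n) :
    u 1 ≤ r * u 0 := by
  by_contra! hlt
  have hu0 : 0 < u 0 := by
    refine (h0 0).lt_of_ne fun h => ?_
    have h1 := hconv 0
    rw [← h, zero_mul, zero_add] at h1
    rw [← h, mul_zero] at hlt
    nlinarith
  set q := u 1 / u 0 with hq
  have hrq : r < q := (lt_div_iff₀ hu0).2 hlt
  have hq0 : 0 < q := hr.trans_lt hrq
  -- Log-convexity makes successive ratios nondecreasing, so all are at least `q > r`; this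
  -- geometric growth will contradict `hD`.
  have hstep (n : ℕ) : 0 < u n ∧ q * u n ≤ u (n + 1) := by
    induction n with
    | zero => exact ⟨hu0, by rw [hq, div_mul_cancel₀ _ hu0.ne']⟩
    | succ n ih =>
      have hpos : 0 < u (n + 1) := (mul_pos hq0 ih.1).trans_le ih.2
      refine ⟨hpos, le_of_mul_le_mul_left ?_ ih.1⟩
      calc u n * (q * u (n + 1)) = (q * u n) * u (n + 1) := by ring
        _ ≤ u (n + 1) * u (n + 1) := by gcongr; exact ih.2
        _ = u (n + 1) ^ 2 := (sq _).symm
        _ ≤ _ := hconv n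
  have hpow (n : ℕ) : q ^ n * u 0 ≤ u n := by
    induction n with
    | zero => simp
    | succ n ih =>
      calc q ^ (n + 1) * u 0 = q * (q ^ n * u 0) := by ring
        _ ≤ q * u n := by gcongr
        _ ≤ _ := (hstep n).2
  have hle (n : ℕ) : u 0 ≤ D * (r / q) ^ n := by
    rw [div_pow, ← mul_div_assoc, le_div_iff₀ (pow_pos hq0 n), mul_comm]
    exact (hpow n).trans (hD n)
  have hlim := (tendsto_pow_atTop_nhds_zero_of_lt_one (div_nonneg hr hq0.le)
    ((div_lt_one hq0).2 hrq)).const_mul D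
  rw [mul_zero] at hlim
  exact hu0.not_ge (ge_of_tendsto' hlim hle)

variable {A : Type u} [CStarAlgebra A] [PartialOrder A] {α : Flow A} {β : ℝ} {ω : A →ₚ[ℂ] ℂ}

namespace IsKMSState

/-- The half-way point `iβ/2` of the KMS strip. -/
abbrev half (β : ℝ) : ℂ := Complex.I * β / 2

/-- Three lines theorem for `w ↦ ω(a α^{iβw}(b))`, evaluated at `w = 1/2`. On `Re w = 0` the flow
time is real; on `Re w = 1` the KMS condition makes it real by moving `b` to the left of `a`.
Scaling by `iβ` covers every sign of `β`. -/
lemma norm_apply_mul_complexAut_le (hω : IsKMSState α β ω) {C : ℝ} (hC0 : 0 ≤ C)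
    (hC : ∀ x, ‖ω x‖ ≤ C * ‖x‖) (hωc : Continuous ω) (a : A) {b : A}
    (hb : b ∈ α.analyticElements) :
    ‖ω (a * α.complexAut (half β) b)‖ ≤ C * (‖a‖ * ‖b‖) := by
  have hF := Flow.isEntireExtension_complexAut hb
  let ω' : A →L[ℂ] ℂ := ⟨ω.toLinearMap, hωc⟩
  let f : ℂ → ℂ := fun w => ω' (a * α.complexAut (w * (Complex.I * β)) b)
  have hd : Differentiable ℂ f := by
    have h1 : Differentiable ℂ fun w : ℂ => α.complexAut (w * (Complex.I * β)) b :=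
      hF.1.comp (differentiable_id.mul_const _)
    exact ω'.differentiable.comp ((differentiable_const a).mul h1)
  have him (w : ℂ) : (w * (Complex.I * β)).im = w.re * β := by simp
  have hbound (x y : A) : ‖ω (x * y)‖ ≤ C * (‖x‖ * ‖y‖) :=
    (hC _).trans (mul_le_mul_of_nonneg_left (norm_mul_le _ _) hC0)
  have key := Complex.HadamardThreeLines.norm_le_interp_of_mem_verticalClosedStrip₀₁' f
    (z := 1 / 2) (a := C * (‖a‖ * ‖b‖)) (b := C * (‖a‖ * ‖b‖))
    (by constructor <;> norm_num) hd.diffContOnCl ?_ ?_ ?_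
  · have hz : (1 / 2 : ℂ) * (Complex.I * β) = half β := by rw [half]; ring
    have hre : ((1 : ℂ) / 2).re = 1 / 2 := by norm_num
    have hM : 0 ≤ C * (‖a‖ * ‖b‖) := by positivity
    rw [hre, show (1 : ℝ) - 1 / 2 = 1 / 2 by norm_num, ← Real.sqrt_eq_rpow,
      Real.mul_self_sqrt hM] at key
    rw [← hz]
    exact key
  -- Boundedness on the closed strip: the norm of the orbit depends only on `w.re`, which ranges
  -- over a compact interval.
  · have hcont : Continuous fun s : ℝ => ‖α.complexAut (s * Complex.I) b‖ :=
      (hF.1.continuous.comp (by fun_prop)).norm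
    obtain ⟨K, hK⟩ := ((isCompact_Icc (a := (0 : ℝ)) (b := 1)).image
      (f := fun s : ℝ => ‖α.complexAut ((s * β : ℝ) * Complex.I) b‖)
      (hcont.comp (continuous_id.mul continuous_const))).bddAbove
    refine ⟨C * (‖a‖ * K), ?_⟩
    rintro _ ⟨w, hw, rfl⟩
    refine (hbound _ _).trans ?_
    rw [Flow.norm_complexAut _ hb, him]
    have := hK ⟨w.re, hw, rfl⟩
    gcongr
  · intro w hw
    refine (hbound _ _).trans (le_of_eq ?_)
    rw [Flow.norm_complexAut _ hb, him, show w.re = 0 from hw]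
    simp [Flow.complexAut_zero hb]
  · intro w hw
    have hz : w * (Complex.I * β) = Complex.I * β + (-(w.im * β) : ℝ) := by
      apply Complex.ext <;> simp [show w.re = 1 from hw]
    have : f w = ω (α.aut (-(w.im * β)) b * a) := by
      change ω _ = _
      rw [← hF.2, hω.2 _ (Flow.complexAut_mem _ hb), Flow.complexAut_complexAut _ _ hb, ← hz]
    rw [this]
    refine (hbound _ _).trans (le_of_eq ?_)
    rw [α.norm_aut, mul_comm ‖a‖]

/-- The adjoint turns `α^{iβ/2}(b)` into `α^{-iβ/2}(b^*)` on the far left; the KMS condition carries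
it to the far right with time `-iβ/2 + iβ = iβ/2`. This symmetry is why the half-way point is used.
-/
lemma apply_star_mul_mul (hω : IsKMSState α β ω) (x y : A) {b : A}
    (hb : b ∈ α.analyticElements) :
    ω (star (x * α.complexAut (half β) b) * y) =
      ω (star x * (y * α.complexAut (half β) (star b))) := by
  have h1 : star (half β) = -half β := by simp [half, neg_div]
  have h2 : star (α.complexAut (half β) b) = α.complexAut (-half β) (star b) := by
    rw [Flow.complexAut_star _ hb, ← h1, star_star]
  rw [star_mul, h2, mul_assoc, hω.2 _ (Flow.complexAut_mem _ (Flow.star_mem hb)),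
    Flow.complexAut_complexAut _ _ (Flow.star_mem hb), mul_assoc]
  congr 4
  rw [half]
  ring

variable (α β ω) in
/-- Right multiplication by `α^{iβ/2}(b)` on the pre-GNS space. -/
def rightMulₗ (b : A) : ω.PreGNS →ₗ[ℂ] ω.PreGNS :=
  ω.toPreGNS.toLinearMap ∘ₗ LinearMap.mulRight ℂ (α.complexAut (half β) b) ∘ₗ
    ω.ofPreGNS.toLinearMap

lemma rightMulₗ_apply (b : A) (x : ω.PreGNS) :
    rightMulₗ α β ω b x = ω.toPreGNS (ω.ofPreGNS x * α.complexAut (half β) b) := rfl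

lemma rightMulₗ_mul {b c : A} (hb : b ∈ α.analyticElements) (hc : c ∈ α.analyticElements)
    (x : ω.PreGNS) :
    rightMulₗ α β ω (b * c) x = rightMulₗ α β ω c (rightMulₗ α β ω b x) := by
  simp only [rightMulₗ_apply, Flow.complexAut_mul _ hb hc, ← mul_assoc,
    PositiveLinearMap.ofPreGNS_toPreGNS]

variable [StarOrderedRing A]

lemma inner_rightMulₗ_left (hω : IsKMSState α β ω) {b : A} (hb : b ∈ α.analyticElements)
    (x y : ω.PreGNS) :
    ⟪rightMulₗ α β ω b x, y⟫_ℂ = ⟪x, rightMulₗ α β ω (star b) y⟫_ℂ :=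
  hω.apply_star_mul_mul (ω.ofPreGNS x) (ω.ofPreGNS y) hb

lemma norm_rightMulₗ_sq (hω : IsKMSState α β ω) {b : A} (hb : b ∈ α.analyticElements)
    (x : ω.PreGNS) :
    ((‖rightMulₗ α β ω b x‖ ^ 2 : ℝ) : ℂ) = ⟪x, rightMulₗ α β ω (b * star b) x⟫_ℂ := by
  rw [rightMulₗ_mul hb (Flow.star_mem hb), ← hω.inner_rightMulₗ_left hb,
    inner_self_eq_norm_sq_to_K]
  simp

/-- An a priori bound in the algebra norm of `x`, too weak to extend `R_b` to the GNS space, but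
with a constant independent of `b`, so it can be applied to all powers of one element. -/
lemma exists_norm_rightMulₗ_le (hω : IsKMSState α β ω) :
    ∃ D : ℝ, 0 ≤ D ∧ ∀ b ∈ α.analyticElements, ∀ x : ω.PreGNS,
      ‖rightMulₗ α β ω b x‖ ≤ D * ‖ω.ofPreGNS x‖ * ‖b‖ := by
  obtain ⟨C, hC⟩ := ω.exists_norm_apply_le
  have hωc : Continuous ω :=
    (ω.toLinearMap.mkContinuous C hC).continuous
  refine ⟨√C, Real.sqrt_nonneg _, fun b hb x => ?_⟩
  refine abs_le_of_sq_le_sq' ?_ (by positivity) |>.2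
  have h1 := hω.norm_apply_mul_complexAut_le C.coe_nonneg hC hωc
    (star (ω.ofPreGNS x) * ω.ofPreGNS x) (Flow.mul_mem hb (Flow.star_mem hb))
  rw [CStarRing.norm_star_mul_self, CStarRing.norm_self_mul_star] at h1
  have h2 := congrArg norm (hω.norm_rightMulₗ_sq hb x)
  rw [Complex.norm_real, Real.norm_of_nonneg (by positivity)] at h2
  rw [h2, mul_pow, mul_pow, Real.sq_sqrt C.coe_nonneg]
  rw [mul_assoc] at h1
  refine h1.trans (le_of_eq ?_)
  ring

/-- Cauchy–Schwarz for `‖R_{h^{n+1}} x‖² = ⟪R_{h^n} x, R_{h^{n+2}} x⟫` gives log-convexity, and the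
a priori bound gives growth `O(‖h‖^n)`. -/
lemma norm_rightMulₗ_le_of_isSelfAdjoint (hω : IsKMSState α β ω) {h : A}
    (hh : h ∈ α.analyticElements) (hsa : IsSelfAdjoint h) (x : ω.PreGNS) :
    ‖rightMulₗ α β ω h x‖ ≤ ‖h‖ * ‖x‖ := by
  obtain ⟨D, hD0, hD⟩ := hω.exists_norm_rightMulₗ_le
  have hmem (n : ℕ) : h ^ n ∈ α.analyticElements := by
    induction n with
    | zero => rw [pow_zero]; exact Flow.one_mem
    | succ n ih => rw [pow_succ]; exact Flow.mul_mem ih hh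
  have key := le_mul_of_sq_le_mul_of_le_pow
    (u := fun n => ‖rightMulₗ α β ω (h ^ n) x‖) (r := ‖h‖)
    -- The maximum covers `n = 0`, where `h ^ 0 = 1` and `‖1‖ = 1` is not assumed, since `A` may be
    -- trivial.
    (D := D * ‖ω.ofPreGNS x‖ * max 1 ‖(1 : A)‖)
    (fun n => norm_nonneg _) (norm_nonneg _) (fun n => ?_) (fun n => ?_)
  · have h0 : rightMulₗ α β ω 1 x = x := by
      rw [rightMulₗ_apply, Flow.complexAut_one, mul_one, PositiveLinearMap.toPreGNS_ofPreGNS]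
    simpa [h0] using key
  · have h1 : rightMulₗ α β ω (h ^ (n + 1)) x =
        rightMulₗ α β ω h (rightMulₗ α β ω (h ^ n) x) := by
      rw [pow_succ, rightMulₗ_mul (hmem n) hh]
    have h2 : rightMulₗ α β ω (h ^ (n + 2)) x =
        rightMulₗ α β ω h (rightMulₗ α β ω (h ^ (n + 1)) x) := by
      rw [pow_succ _ (n + 1), rightMulₗ_mul (hmem _) hh]
    rw [← inner_self_eq_norm_sq (𝕜 := ℂ)]
    nth_rw 1 [h1]
    rw [hω.inner_rightMulₗ_left hh, hsa.star_eq, ← h2]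
    exact (RCLike.re_le_norm _).trans (norm_inner_le_norm _ _)
  · refine (hD _ (hmem n) x).trans ?_
    rw [mul_assoc _ (max _ _)]
    gcongr
    cases n with
    | zero => simp
    | succ n =>
      refine (norm_pow_le' h n.succ_pos).trans (le_mul_of_one_le_left (by positivity) ?_)
      exact le_max_left _ _

lemma norm_rightMulₗ_le (hω : IsKMSState α β ω) {b : A} (hb : b ∈ α.analyticElements)
    (x : ω.PreGNS) : ‖rightMulₗ α β ω b x‖ ≤ ‖b‖ * ‖x‖ := by
  refine abs_le_of_sq_le_sq' ?_ (by positivity) |>.2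
  have h2 := congrArg norm (hω.norm_rightMulₗ_sq hb x)
  rw [Complex.norm_real, Real.norm_of_nonneg (by positivity)] at h2
  rw [h2]
  refine (norm_inner_le_norm _ _).trans ?_
  have h3 := hω.norm_rightMulₗ_le_of_isSelfAdjoint (Flow.mul_mem hb (Flow.star_mem hb))
    (IsSelfAdjoint.mul_star_self b) x
  rw [CStarRing.norm_self_mul_star] at h3
  calc _ ≤ ‖x‖ * (‖b‖ * ‖b‖ * ‖x‖) := by gcongr
    _ = _ := by ring

/-- The right action of an analytic element on the GNS space. -/
def rightMulCLM (hω : IsKMSState α β ω) (b : α.analyticSubmodule) : ω.GNS →L[ℂ] ω.GNS :=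
  ((rightMulₗ α β ω b.1).mkContinuous ‖b.1‖ (hω.norm_rightMulₗ_le b.2)).completion

lemma rightMulCLM_coe (hω : IsKMSState α β ω) (b : α.analyticSubmodule) (x : ω.PreGNS) :
    hω.rightMulCLM b x = (rightMulₗ α β ω b.1 x : ω.PreGNS) :=
  ContinuousLinearMap.completion_apply_coe _ x

end IsKMSState

end SphericalKMS

/-! ### The GNS vector and operators on the GNS space. -/

namespace PositiveLinearMap

open UniformSpace

variable {A : Type u} [CStarAlgebra A] [PartialOrder A] [StarOrderedRing A] {ω : A →ₚ[ℂ] ℂ}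

lemma gnsStarAlgHom_coe (a : A) (x : ω.PreGNS) :
    ω.gnsStarAlgHom a x = (ω.toPreGNS (a * ω.ofPreGNS x) : ω.PreGNS) :=
  gnsNonUnitalStarAlgHom_apply_coe ω

/-- Two bounded operators on the GNS space agree if they agree on the image of `A`. -/
lemma clm_ext_coe {S T : ω.GNS →L[ℂ] ω.GNS}
    (h : ∀ x : ω.PreGNS, S x = T x) : S = T := by
  ext x
  induction x using Completion.induction_on with
  | hp => exact isClosed_eq (by fun_prop) (by fun_prop)
  | ih x => exact h x

variable (ω) in
/-- The cyclic vector of the GNS space. -/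
def gnsVector : ω.GNS := (ω.toPreGNS 1 : ω.PreGNS)

lemma gnsStarAlgHom_gnsVector (a : A) :
    ω.gnsStarAlgHom a ω.gnsVector = (ω.toPreGNS a : ω.PreGNS) := by
  rw [gnsVector, gnsStarAlgHom_coe,
    ofPreGNS_toPreGNS, mul_one]

end PositiveLinearMap

namespace SphericalKMS

lemma IsState.norm_gnsVector {A : Type u} [CStarAlgebra A] [PartialOrder A] [StarOrderedRing A]
    {ω : A →ₚ[ℂ] ℂ} (hω : IsState ω) : ‖ω.gnsVector‖ = 1 := by
  rw [PositiveLinearMap.gnsVector, UniformSpace.Completion.norm_coe, PositiveLinearMap.preGNS_norm_def]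
  simp [show ω 1 = 1 from hω]


/-! ### The commuting right representation and the resulting spherical representation. -/

namespace IsKMSState

open MulOpposite UniformSpace

variable {A : Type u} [CStarAlgebra A] [PartialOrder A] [StarOrderedRing A] {α : Flow A} {β : ℝ}
  {ω : A →ₚ[ℂ] ℂ}

lemma norm_rightMulCLM_le (hω : IsKMSState α β ω) (b : α.analyticSubmodule) :
    ‖hω.rightMulCLM b‖ ≤ ‖b.1‖ := by
  refine ContinuousLinearMap.opNorm_le_bound _ (norm_nonneg _) fun x => ?_
  induction x using Completion.induction_on with
  | hp => exact isClosed_le (by fun_prop) (by fun_prop)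
  | ih x =>
    rw [rightMulCLM_coe, Completion.norm_coe, Completion.norm_coe]
    exact hω.norm_rightMulₗ_le b.2 x

/-- The right action of analytic elements, as a linear map. -/
def rightMulLinear (hω : IsKMSState α β ω) :
    α.analyticSubmodule →ₗ[ℂ] (ω.GNS →L[ℂ] ω.GNS) where
  toFun := hω.rightMulCLM
  map_add' b c := PositiveLinearMap.clm_ext_coe fun x => by
    rw [add_apply, rightMulCLM_coe, rightMulCLM_coe, rightMulCLM_coe,
      ← Completion.coe_add, rightMulₗ_apply, Submodule.coe_add, Flow.complexAut_add _ b.2 c.2,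
      mul_add, map_add]
    rfl
  map_smul' c b := PositiveLinearMap.clm_ext_coe fun x => by
    rw [RingHom.id_apply, smul_apply, rightMulCLM_coe, rightMulCLM_coe,
      ← Completion.coe_smul, rightMulₗ_apply, Submodule.coe_smul, Flow.complexAut_smul _ _ b.2,
      mul_smul_comm, map_smul]
    rfl

/-- The right action of `A` on the GNS space, by continuous extension from the analytic
elements. -/
def rightAction (hω : IsKMSState α β ω) : A →L[ℂ] (ω.GNS →L[ℂ] ω.GNS) :=
  hω.rightMulLinear.extendOfNorm α.analyticSubmodule.subtype

lemma rightAction_coe (hω : IsKMSState α β ω) {b : A} (hb : b ∈ α.analyticElements)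
    (x : ω.PreGNS) : hω.rightAction b x = (rightMulₗ α β ω b x : ω.PreGNS) := by
  have h := LinearMap.extendOfNorm_eq (f := hω.rightMulLinear) (α.denseRange_analyticSubmodule_subtype)
    ⟨1, fun b => by rw [one_mul]; exact hω.norm_rightMulCLM_le b⟩ ⟨b, hb⟩
  exact (congrArg (fun T : ω.GNS →L[ℂ] ω.GNS => T x) h).trans (hω.rightMulCLM_coe ⟨b, hb⟩ x)

lemma rightAction_one (hω : IsKMSState α β ω) : hω.rightAction 1 = 1 :=
  PositiveLinearMap.clm_ext_coe fun x => by
    rw [rightAction_coe _ Flow.one_mem, rightMulₗ_apply, Flow.complexAut_one, mul_one]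
    rfl

lemma rightAction_mul (hω : IsKMSState α β ω) (b c : A) :
    hω.rightAction (b * c) = hω.rightAction c * hω.rightAction b := by
  refine (α.denseRange_analyticSubmodule_subtype).induction_on₂
    (p := fun b c => hω.rightAction (b * c) = hω.rightAction c * hω.rightAction b)
    (isClosed_eq (by fun_prop) (by fun_prop)) (fun b c => ?_) b c
  refine PositiveLinearMap.clm_ext_coe fun x => ?_
  simp only [Submodule.subtype_apply]
  rw [mul_apply_eq_comp, rightAction_coe _ b.2, rightAction_coe _ c.2,
    ← rightMulₗ_mul b.2 c.2]
  exact rightAction_coe _ (Flow.mul_mem b.2 c.2) x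

lemma rightAction_star (hω : IsKMSState α β ω) (b : A) :
    hω.rightAction (star b) = star (hω.rightAction b) := by
  refine (α.denseRange_analyticSubmodule_subtype).induction_on
    (p := fun b => hω.rightAction (star b) = star (hω.rightAction b)) b
    (isClosed_eq (by fun_prop) (by fun_prop)) fun b => ?_
  refine (ContinuousLinearMap.eq_adjoint_iff _ _).2 fun x y => ?_
  induction x, y using Completion.induction_on₂ with
  | hp => exact isClosed_eq (by fun_prop) (by fun_prop)
  | ih x y =>
    have h := hω.inner_rightMulₗ_left (Flow.star_mem b.2) x y
    rw [star_star] at h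
    simp only [Submodule.subtype_apply]
    rw [rightAction_coe _ (Flow.star_mem b.2), rightAction_coe _ b.2, Completion.inner_coe,
      Completion.inner_coe]
    exact h

lemma commute_rightAction (hω : IsKMSState α β ω) (a b : A) :
    Commute (ω.gnsStarAlgHom a) (hω.rightAction b) := by
  refine (α.denseRange_analyticSubmodule_subtype).induction_on
    (p := fun b => ω.gnsStarAlgHom a * hω.rightAction b = hω.rightAction b * ω.gnsStarAlgHom a) b
    (isClosed_eq (by fun_prop) (by fun_prop)) fun b => ?_
  refine PositiveLinearMap.clm_ext_coe fun x => ?_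
  simp only [Submodule.subtype_apply]
  rw [mul_apply_eq_comp, mul_apply_eq_comp, rightAction_coe _ b.2,
    PositiveLinearMap.gnsStarAlgHom_coe, PositiveLinearMap.gnsStarAlgHom_coe,
    rightAction_coe _ b.2]
  simp [rightMulₗ_apply, mul_assoc]

/-- The right action as a representation of the opposite algebra. -/
def rightRep (hω : IsKMSState α β ω) : Aᵐᵒᵖ →⋆ₐ[ℂ] (ω.GNS →L[ℂ] ω.GNS) where
  toFun b := hω.rightAction b.unop
  map_one' := hω.rightAction_one
  map_mul' b c := hω.rightAction_mul c.unop b.unop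
  map_zero' := map_zero _
  map_add' b c := map_add _ b.unop c.unop
  commutes' c := by
    rw [Algebra.algebraMap_eq_smul_one, unop_smul, map_smul, unop_one, hω.rightAction_one,
      Algebra.algebraMap_eq_smul_one]
  map_star' b := hω.rightAction_star b.unop

/-- The representation of `A ⊗_max Aᵒᵖ` on the GNS space of a KMS state. -/
def doubleRep (hω : IsKMSState α β ω) : Double A →⋆ₐ[ℂ] (ω.GNS →L[ℂ] ω.GNS) :=
  MaxTensor.lift ω.gnsStarAlgHom hω.rightRep fun a b => hω.commute_rightAction a b.unop

lemma doubleRep_tmul (hω : IsKMSState α β ω) (a : A) (b : Aᵐᵒᵖ) :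
    hω.doubleRep (MaxTensor.tmul a b) = ω.gnsStarAlgHom a * hω.rightRep b :=
  MaxTensor.lift_tmul _ _ _ a b

/-- Left multiplication alone already makes the GNS vector cyclic. It is spherical because the shift
`iβ/2` built into the right action cancels the shift `-iβ/2` of the spherical condition. -/
theorem isSphericalRepresentation (hω : IsKMSState α β ω) :
    IsSphericalRepresentation α β hω.doubleRep ω.gnsVector where
  norm_eq_one := hω.1.norm_gnsVector
  cyclic := by
    refine (Completion.denseRange_coe (α := ω.PreGNS)).mono ?_
    rintro _ ⟨x, rfl⟩
    refine ⟨MaxTensor.tmul (ω.ofPreGNS x) 1, ?_⟩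
    beta_reduce
    rw [doubleRep_tmul, map_one, mul_one,
      PositiveLinearMap.gnsStarAlgHom_gnsVector]
    rfl
  spherical a ha := by
    have hmem := Flow.complexAut_mem (-(Complex.I * β / 2)) ha
    rw [doubleRep_tmul, doubleRep_tmul, op_one, map_one, map_one, mul_one,
      one_mul, PositiveLinearMap.gnsStarAlgHom_gnsVector]
    refine Eq.symm ((hω.rightAction_coe hmem _).trans ?_)
    rw [rightMulₗ_apply, Flow.complexAut_complexAut _ _ ha, half, add_neg_cancel,
      Flow.complexAut_zero ha, PositiveLinearMap.ofPreGNS_toPreGNS, one_mul]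

end IsKMSState

end SphericalKMS

namespace SphericalKMS

open MulOpposite

/-! ### From spherical vectors to KMS states -/

section Spherical

variable {A : Type u} [CStarAlgebra A] {α : Flow A} {β : ℝ}
  {H : Type u} [NormedAddCommGroup H] [InnerProductSpace ℂ H] [CompleteSpace H]

/-- The vector functional `a ↦ ⟪ξ, ρ(a ⊗ 1) ξ⟫`. -/
def vectorFunctional [PartialOrder A] [StarOrderedRing A]
    (ρ : Double A →⋆ₐ[ℂ] (H →L[ℂ] H)) (ξ : H) : A →ₚ[ℂ] ℂ :=
  PositiveLinearMap.mk₀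
    { toFun := fun a => ⟪ξ, ρ (MaxTensor.tmul a 1) ξ⟫_ℂ
      map_add' := fun a b => by
        rw [MaxTensor.tmul_add_left, map_add, add_apply, inner_add_right]
      map_smul' := fun c a => by
        rw [MaxTensor.tmul_smul_left, map_smul, smul_apply, inner_smul_right]
        rfl }
    fun a ha => by
      obtain ⟨b, rfl⟩ := CStarAlgebra.nonneg_iff_eq_star_mul_self.1 ha
      have h : MaxTensor.tmul (star b * b) (1 : Aᵐᵒᵖ) =
          star (MaxTensor.tmul b 1) * MaxTensor.tmul b 1 := by
        rw [MaxTensor.star_tmul, MaxTensor.tmul_mul_tmul, star_one, one_mul]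
      change 0 ≤ ⟪ξ, ρ (MaxTensor.tmul (star b * b) 1) ξ⟫_ℂ
      rw [h, map_mul, map_star, mul_apply_eq_comp,
        ContinuousLinearMap.star_eq_adjoint, ContinuousLinearMap.adjoint_inner_right,
        inner_self_eq_norm_sq_to_K]
      rw [← RCLike.ofReal_pow]
      exact RCLike.ofReal_nonneg.2 (sq_nonneg _)

/-- The vector functional of a spherical unit vector is a KMS state. -/
theorem isKMSState_vectorFunctional [PartialOrder A] [StarOrderedRing A]
    (ρ : Double A →⋆ₐ[ℂ] (H →L[ℂ] H)) {ξ : H} (hnorm : ‖ξ‖ = 1)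
    (hξ : ξ ∈ sphericalVectors α β ρ) : IsKMSState α β (vectorFunctional ρ ξ) := by
  refine ⟨?_, fun a ha b => ?_⟩
  · change ⟪ξ, ρ (MaxTensor.tmul 1 1) ξ⟫_ℂ = 1
    rw [MaxTensor.tmul_one_one, map_one, one_apply_eq_self,
      inner_self_eq_norm_sq_to_K, hnorm]
    simp
  · change ⟪ξ, ρ (MaxTensor.tmul (a * b) 1) ξ⟫_ℂ =
      ⟪ξ, ρ (MaxTensor.tmul (b * α.complexAut (Complex.I * β) a) 1) ξ⟫_ℂ
    have hsplit (x y : A) : MaxTensor.tmul (x * y) (1 : Aᵐᵒᵖ) =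
        MaxTensor.tmul x 1 * MaxTensor.tmul y 1 := by
      rw [MaxTensor.tmul_mul_tmul, one_mul]
    have hcomm (x : A) (y : Aᵐᵒᵖ) : MaxTensor.tmul (1 : A) y * MaxTensor.tmul x 1 =
        MaxTensor.tmul x 1 * MaxTensor.tmul 1 y := by
      simp [MaxTensor.tmul_mul_tmul]
    -- With this `c`, sphericality gives `(a^* ⊗ 1)ξ = (1 ⊗ c^op)^* ξ` and `(α^{iβ}(a) ⊗ 1)ξ = (1 ⊗
    -- c^op)ξ`. The two sides of the KMS identity then differ only in the order of `1 ⊗ c^op` and `b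
    -- ⊗ 1`.
    set c := α.complexAut (Complex.I * β / 2) a with hc
    have hleft : ρ (MaxTensor.tmul (star a) 1) ξ = ρ (star (MaxTensor.tmul 1 (op c))) ξ := by
      have h := hξ (star a) (Flow.star_mem ha)
      rw [op_one] at h
      rw [h, MaxTensor.star_tmul, star_one, ← op_star, hc, Flow.complexAut_star _ ha]
      congr 6
      simp [neg_div]
    have hright : ρ (MaxTensor.tmul (α.complexAut (Complex.I * β) a) 1) ξ =
        ρ (MaxTensor.tmul 1 (op c)) ξ := by
      have h := hξ _ (Flow.complexAut_mem (Complex.I * β) ha)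
      rw [op_one] at h
      rw [h, hc, Flow.complexAut_complexAut _ _ ha]
      congr 6
      ring
    have hadj (x : Double A) (η ζ : H) : ⟪η, ρ x ζ⟫_ℂ = ⟪ρ (star x) η, ζ⟫_ℂ := by
      rw [map_star, ContinuousLinearMap.star_eq_adjoint, ContinuousLinearMap.adjoint_inner_left]
    rw [hsplit, hsplit, map_mul, map_mul, mul_apply_eq_comp,
      mul_apply_eq_comp, hright, hadj, MaxTensor.star_tmul, star_one, hleft,
      ← hadj, ← mul_apply_eq_comp, ← mul_apply_eq_comp,
      ← map_mul, ← map_mul, hcomm]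

/-- A nonzero spherical vector in some representation gives a KMS state. -/
theorem exists_isKMSState_of_ne_zero [PartialOrder A] [StarOrderedRing A]
    (ρ : Double A →⋆ₐ[ℂ] (H →L[ℂ] H)) {ξ : H} (hne : ξ ≠ 0)
    (hξ : ξ ∈ sphericalVectors α β ρ) : ∃ ω : A →ₚ[ℂ] ℂ, IsKMSState α β ω :=
  ⟨_, isKMSState_vectorFunctional ρ (ξ := ((‖ξ‖ : ℂ)⁻¹) • ξ)
    (by rw [norm_smul, norm_inv, Complex.norm_real, norm_norm,
      inv_mul_cancel₀ (norm_ne_zero_iff.2 hne)])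
    (Submodule.smul_mem _ _ hξ)⟩

/-- The left ideal annihilates spherical vectors. -/
lemma apply_eq_zero_of_mem_sphericalLeftIdeal {ρ : Double A →⋆ₐ[ℂ] (H →L[ℂ] H)} {ξ : H}
    (hξ : ξ ∈ sphericalVectors α β ρ) {x : Double A} (hx : x ∈ sphericalLeftIdeal α β) :
    ρ x ξ = 0 := by
  refine Submodule.span_induction ?_ ?_ ?_ ?_ hx
  · rintro _ ⟨a, ha, rfl⟩
    rw [map_sub, sub_apply, hξ a ha, sub_self]
  · rw [map_zero, zero_apply]
  · intro x y _ _ h1 h2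
    rw [map_add, add_apply, h1, h2, add_zero]
  · intro x y _ h
    rw [smul_eq_mul, map_mul, mul_apply_eq_comp, h, map_zero]

lemma sphericalLeftIdeal_ne_top {ρ : Double A →⋆ₐ[ℂ] (H →L[ℂ] H)} {ξ : H}
    (h : IsSphericalRepresentation α β ρ ξ) : sphericalLeftIdeal α β ≠ ⊤ := by
  intro htop
  have h1 : ρ 1 ξ = 0 :=
    apply_eq_zero_of_mem_sphericalLeftIdeal h.spherical (htop ▸ Submodule.mem_top)
  rw [map_one, one_apply_eq_self] at h1
  have := h.norm_eq_one
  rw [h1, norm_zero] at this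
  exact zero_ne_one this

end Spherical

/-! ### States vanishing on a proper left ideal -/

section LeftIdeal

variable {B : Type u} [CStarAlgebra B]

/-- Otherwise the Neumann series makes `-l = 1 - (1 + l)` a unit lying in `L`. -/
lemma one_le_norm_one_add {L : Ideal B} (hL : L ≠ ⊤) {l : B} (hl : l ∈ L) :
    1 ≤ ‖(1 : B) + l‖ := by
  by_contra! hlt
  have hu := isUnit_one_sub_of_norm_lt_one hlt
  rw [sub_add_cancel_left] at hu
  exact hL (Ideal.eq_top_of_isUnit_mem L (L.neg_mem hl) hu)

/-- Comparing `|f(x + it)|²` with `‖x + it‖² ≤ ‖x‖² + t²`, the terms `t²` cancel and an inequality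
linear in `t` remains, which fails for suitable `t` unless the imaginary part vanishes. -/
lemma im_apply_eq_zero_of_isSelfAdjoint {f : B →L[ℂ] ℂ} (hf : ∀ x, ‖f x‖ ≤ ‖x‖) (h1 : f 1 = 1)
    {x : B} (hx : IsSelfAdjoint x) : (f x).im = 0 := by
  have : Nontrivial B := ⟨1, 0, fun h => by simp [h] at h1⟩
  by_contra hq
  set q := (f x).im
  set M := ‖x‖ ^ 2
  have hM : 0 ≤ M := sq_nonneg _
  have key (t : ℝ) : (q + t) ^ 2 ≤ M + t ^ 2 := by
    set y : B := x + ((t : ℂ) * Complex.I) • 1 with hy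
    have h2 : star y * y = x * x + ((t : ℂ) ^ 2) • 1 := by
      have hs : star ((t : ℂ) * Complex.I) = -((t : ℂ) * Complex.I) := by simp
      rw [hy, star_add, star_smul, hs, hx.star_eq, star_one]
      simp only [add_mul, mul_add, smul_mul_assoc, mul_smul_comm, one_mul, mul_one]
      have hI : -((t : ℂ) * Complex.I) * ((t : ℂ) * Complex.I) = (t : ℂ) ^ 2 := by
        linear_combination -(t : ℂ) ^ 2 * Complex.I_sq
      rw [smul_add, smul_smul, mul_comm ((t : ℂ) * Complex.I), hI]
      module
    have h3 : ‖y‖ ^ 2 ≤ M + t ^ 2 := by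
      rw [sq, ← CStarRing.norm_star_mul_self, h2]
      refine (norm_add_le _ _).trans (add_le_add ((norm_mul_le _ _).trans (sq _).ge) ?_)
      rw [norm_smul, CStarRing.norm_one, mul_one, norm_pow, Complex.norm_real, Real.norm_eq_abs,
        sq_abs]
    have h4 : (f y).im = q + t := by
      rw [hy, map_add, map_smul, h1]
      simp [q]
    have h5 : |q + t| ≤ ‖y‖ := h4 ▸ (Complex.abs_im_le_norm _).trans (hf y)
    calc (q + t) ^ 2 = |q + t| ^ 2 := (sq_abs _).symm
      _ ≤ ‖y‖ ^ 2 := by gcongr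
      _ ≤ _ := h3
  have h6 := key (M / q)
  have h7 : q * (M / q) = M := mul_div_cancel₀ M hq
  have h8 : 0 < q ^ 2 := by positivity
  nlinarith

/-- A contractive functional with `f 1 = 1` is positive. -/
lemma nonneg_of_norm_le_of_apply_one [PartialOrder B] [StarOrderedRing B] {f : B →L[ℂ] ℂ}
    (hf : ∀ x, ‖f x‖ ≤ ‖x‖) (h1 : f 1 = 1) {x : B} (hx : 0 ≤ x) : 0 ≤ f x := by
  have hsa : IsSelfAdjoint x := .of_nonneg hx
  refine Complex.nonneg_iff.2 ⟨?_, (im_apply_eq_zero_of_isSelfAdjoint hf h1 hsa).symm⟩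
  have hle : x ≤ algebraMap ℝ B ‖x‖ := hsa.le_algebraMap_norm_self
  -- From `0 ≤ ‖x‖ - x ≤ ‖x‖`; contractivity then puts `f x` within `‖x‖` of `‖x‖`, so its real part
  -- is nonnegative.
  have hnorm : ‖algebraMap ℝ B ‖x‖ - x‖ ≤ ‖x‖ :=
    (CStarAlgebra.norm_le_iff_le_algebraMap _ (norm_nonneg x) (sub_nonneg.2 hle)).2
      (sub_le_self _ hx)
  have hval : f (algebraMap ℝ B ‖x‖ - x) = (‖x‖ : ℂ) - f x := by
    rw [map_sub, Algebra.algebraMap_eq_smul_one, ← Complex.coe_smul, map_smul, h1, smul_eq_mul,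
      mul_one]
  have h2 := ((Complex.re_le_norm _).trans (hf _)).trans hnorm
  rw [hval, Complex.sub_re, Complex.ofReal_re] at h2
  linarith

/-- Every proper left ideal is annihilated by a state. -/
lemma exists_state_of_ne_top [PartialOrder B] [StarOrderedRing B] {L : Ideal B} (hL : L ≠ ⊤) :
    ∃ φ : State B, ∀ x ∈ L, φ.1 x = 0 := by
  let S : Submodule ℂ B := L.restrictScalars ℂ
  have hq : 1 ≤ ‖(Submodule.Quotient.mk 1 : B ⧸ S)‖ := by
    refine QuotientAddGroup.le_norm_iff.2 fun m hm => ?_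
    have h := one_le_norm_one_add hL ((Submodule.Quotient.eq S).1 hm)
    rwa [add_sub_cancel] at h
  -- Hahn–Banach on the quotient, where the class of `1` has norm exactly one. A seminorm suffices,
  -- so `L` need not be closed.
  obtain ⟨g, hg, hg1⟩ := exists_dual_vector ℂ (Submodule.Quotient.mk 1 : B ⧸ S)
    (one_pos.trans_le hq).ne'
  have hmk (x : B) : ‖(Submodule.Quotient.mk x : B ⧸ S)‖ ≤ ‖x‖ :=
    Submodule.Quotient.norm_mk_le S x
  let f₀ : B →ₗ[ℂ] ℂ := g.toLinearMap ∘ₗ S.mkQ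
  have hf₀ (x : B) : ‖f₀ x‖ ≤ 1 * ‖x‖ := by
    refine (g.le_opNorm _).trans ?_
    rw [hg]
    exact mul_le_mul_of_nonneg_left (hmk x) zero_le_one
  let f : B →L[ℂ] ℂ := f₀.mkContinuous 1 hf₀
  have hf (x : B) : ‖f x‖ ≤ ‖x‖ := (hf₀ x).trans (one_mul _).le
  have : Nontrivial B := ⟨1, 0, fun h => by simp [h] at hq; linarith⟩
  have hf1 : f 1 = 1 := by
    change g (Submodule.Quotient.mk 1) = 1
    rw [hg1, le_antisymm ((hmk 1).trans CStarRing.norm_one.le) hq]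
    simp
  refine ⟨⟨PositiveLinearMap.mk₀ f.toLinearMap
    fun x hx => nonneg_of_norm_le_of_apply_one hf hf1 hx, hf1⟩, fun x hx => ?_⟩
  change g (Submodule.Quotient.mk x) = 0
  rw [(Submodule.Quotient.mk_eq_zero S).2 hx, map_zero]

end LeftIdeal

/-! ### Spherical vectors of the universal representation -/

section Universal

variable {A : Type u} [CStarAlgebra A] {α : Flow A} {β : ℝ}

open Classical in
/-- If the left ideal is proper, the universal representation has a nonzero spherical vector. -/
lemma exists_ne_zero_mem_sphericalVectors_univRep (h : sphericalLeftIdeal α β ≠ ⊤) :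
    ∃ ξ ∈ sphericalVectors α β (univRep (Double A)), ξ ≠ 0 := by
  obtain ⟨φ, hφ⟩ := exists_state_of_ne_top h
  -- A left ideal contains `x^* x` along with `x`, so the squared norm `φ(x^* x)` vanishes.
  have hzero {x : Double A} (hx : x ∈ sphericalLeftIdeal α β) :
      φ.1.gnsStarAlgHom x φ.1.gnsVector = 0 := by
    rw [PositiveLinearMap.gnsStarAlgHom_gnsVector, ← norm_eq_zero,
      UniformSpace.Completion.norm_coe, PositiveLinearMap.preGNS_norm_def,
      PositiveLinearMap.ofPreGNS_toPreGNS, hφ _ (Ideal.mul_mem_left _ _ hx)]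
    simp
  refine ⟨lp.single 2 φ φ.1.gnsVector, fun a ha => ?_, fun h0 => ?_⟩
  · rw [← sub_eq_zero, ← sub_apply, ← map_sub]
    ext ψ
    rw [univRep_apply, lp.coeFn_zero, Pi.zero_apply]
    by_cases hψ : ψ = φ
    · subst hψ
      rw [lp.single_apply_self]
      exact hzero (Ideal.subset_span ⟨a, ha, rfl⟩)
    · rw [lp.single_apply_ne _ _ _ hψ, map_zero]
  · have h1 := congrArg norm h0
    rw [lp.norm_single (by norm_num), φ.2.norm_gnsVector, norm_zero] at h1
    exact one_ne_zero h1

lemma one_le_rank_iff_exists_ne_zero {V : Type*} [AddCommGroup V] [Module ℂ V]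
    (S : Submodule ℂ V) : 1 ≤ Module.rank ℂ S ↔ ∃ ξ ∈ S, ξ ≠ 0 := by
  rw [Cardinal.one_le_iff_pos, rank_pos_iff_nontrivial, Submodule.nontrivial_iff_ne_bot,
    Submodule.ne_bot_iff]

end Universal

end SphericalKMS

end

theorem corollary4p2 {A : Type u} [CStarAlgebra A] [PartialOrder A] [StarOrderedRing A]
    (α : SphericalKMS.Flow A) (β : ℝ) :
    List.TFAE
      [ -- (i) there is a KMS state on `A`
       ∃ ω : A →ₚ[ℂ] ℂ, SphericalKMS.IsKMSState α β ω,
       -- (ii) there is a spherical representation of `A`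
       ∃ (H : Type u) (_ : NormedAddCommGroup H) (_ : InnerProductSpace ℂ H)
         (_ : CompleteSpace H) (ρ : SphericalKMS.Double A →⋆ₐ[ℂ] (H →L[ℂ] H)) (ξ : H),
         SphericalKMS.IsSphericalRepresentation α β ρ ξ,
       -- (iii) the space of spherical vectors of the universal representation has dimension `≥ 1`
       1 ≤ Module.rank ℂ
         (SphericalKMS.sphericalVectors α β (SphericalKMS.univRep (SphericalKMS.Double A))),
       -- (iv) the left ideal generated by the elements `a ⊗ 1 - 1 ⊗ (α^{-iβ/2}(a))^op` is proper
       SphericalKMS.sphericalLeftIdeal α β ≠ ⊤] := by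
  tfae_have 1 → 2 := fun ⟨_, hω⟩ => ⟨_, _, _, _, _, _, hω.isSphericalRepresentation⟩
  tfae_have 2 → 4 := fun ⟨_, _, _, _, _, _, h⟩ => SphericalKMS.sphericalLeftIdeal_ne_top h
  tfae_have 4 → 3 := fun h => (SphericalKMS.one_le_rank_iff_exists_ne_zero _).2
    (SphericalKMS.exists_ne_zero_mem_sphericalVectors_univRep h)
  tfae_have 3 → 1 := fun h =>
    let ⟨_, hξ, hne⟩ := (SphericalKMS.one_le_rank_iff_exists_ne_zero _).1 h
    SphericalKMS.exists_isKMSState_of_ne_zero _ hne hξ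
  tfae_finish
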